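/- Let $K\subset\mathbb{R}^2$ be the Sierpinski gasket on the vertices $p_1,p_2,p_3$ of an equilateral triangle, i.e. the unique nonempty compact set with $K=\bigcup_{i=1}^3\varphi_i(K)$, $\varphi_i(x)=x/2+p_i/2$. Let $$\mathcal{E}(f,g)=\lim_{n}\left(\tfrac53\right)^n\sum_{x\sim_n y}(f(x)-f(y))\overline{(g(x)-g(y))}$$ be its standard self-similar energy form (the sum is over the edges of the $n$-th approximating graph), defined on the algebra $\mathcal{F}_{\mathbb{C}}$ of continuous functions $f:K\to\mathbb{C}$ of finite energy $\mathcal{E}(f)=\mathcal{E}(f,f)$. Let $\nu_{f,g}$, $\nu_f=\nu_{f,f}$ denote the (mutual) energy measures of $f,g\in\mathcal{F}_{\mathbb{C}}$, and let $\nu=\nu_{h_1}+\nu_{h_2}$ be the Kusuoka measure, where $\{h_1,h_2\}$ is a complete energy orthonormal system of (real valued, nonconstant) harmonic functions. Let $\mathcal{H}_{\mathbb{C}}$ be the Hilbert space of $1$-forms, obtained from $\mathcal{F}_{\mathbb{C}}\otimes\mathcal{F}_{\mathbb{C}}$ with $$\langle a\otimes b,c\otimes d\rangle_{\mathcal{H}}=\int_K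 b\overline{d}\,d\nu_{a,c}$$ by factoring out the elements of norm zero and completing; inner products are linear in the first argument. For $f\in\mathcal{F}_{\mathbb{C}}$ let $\partial f=f\otimes\mathbf{1}$; let $\omega\mapsto \omega f$ be the continuous extension of $(a\otimes b)f=a\otimes(bf)$ to $\mathcal{H}_{\mathbb{C}}$, and let $\omega\mapsto\overline{\omega}$ be the continuous extension of $a\otimes b\mapsto\overline{a}\otimes\overline{b}$. Let $\mathcal{H}=\{v\in\mathcal{H}_{\mathbb{C}}:\overline{v}=v\}$. Let $\mathcal{F}_{\mathbb{C}}^*$ be the space of linear functionals on $\mathcal{F}_{\mathbb{C}}$ that are bounded with respect to the norm $\|\varphi\|_\infty+\mathcal{E}(\varphi)^{1/2}$, with the pairing $\langle u,g\rangle=u(\overline{g})$ for $u\in\mathcal{F}_{\mathbb{C}}^*$, $g\in\mathcal{F}_{\mathbb{C}}$. For $a\in\mathcal{H}$, a real valued $V\in L_\infty(K,\nu)$, $v\in\mathcal{H}_{\mathbb{C}}$, $f\in\mathcal{F}_{\mathbb{C}}$ and $u\in\mathcal{F}_{\mathbb{C}}^*$ define elements of $\mathcal{F}_{\mathbb{C}}^*$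 by $$(\Delta_\nu f)(\varphi)=-\mathcal{E}(f,\overline{\varphi}),\quad (\partial^*v)(\varphi)=-\langle v,\partial\overline{\varphi}\rangle_{\mathcal{H}},\quad (a^*v)(\varphi)=\langle a\varphi,\overline{v}\rangle_{\mathcal{H}},\quad (fu)(\varphi)=u(\varphi f),\quad (Vf)(\varphi)=\int_K fV\varphi\,d\nu,$$ $\varphi\in\mathcal{F}_{\mathbb{C}}$, and put $$\mathcal{E}^{a,V}(f,g)=\left\langle -\Delta_\nu f+2i\,a^*(\partial f)+a^*(af)+i\,f(\partial^*a)+Vf,\;g\right\rangle,\qquad f,g\in\mathcal{F}_{\mathbb{C}},$$ where $af=fa$ denotes the product of the $1$-form $a$ with $f$ introduced above and $(-i\partial-a)f=-i\,\partial f-af$. Then: (i) For all $f,g\in\mathcal{F}_{\mathbb{C}}$, $$\mathcal{E}^{a,V}(f,g)=\langle(-i\partial-a)f,(-i\partial-a)g\rangle_{\mathcal{H}}+\langle fV,g\rangle,\qquad \langle fV,g\rangle=\int_K fV\overline{g}\,d\nu .$$ (ii) $\mathcal{E}^{a,V}$ is a quadratic form on $\mathcal{F}_{\mathbb{C}}$,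 i.e. it is linear in the first argument and satisfies $\mathcal{E}^{a,V}(g,f)=\overline{\mathcal{E}^{a,V}(f,g)}$. Moreover $\mathcal{E}^{a,V}(f,f)-\langle fV,f\rangle\ge 0$ for all $f\in\mathcal{F}_{\mathbb{C}}$. -/

import Mathlib

open Set Filter Topology MeasureTheory
open scoped ENNReal TensorProduct ComplexConjugate

noncomputable section

namespace SierpinskiGasket

/-! ### The Sierpinski gasket -/

/-- The Euclidean plane. -/
abbrev Plane : Type := EuclideanSpace ℝ (Fin 2)

/-- The contraction `x ↦ x / 2 + pᵢ / 2`. -/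
def contraction (p : Fin 3 → Plane) (i : Fin 3) (x : Plane) : Plane :=
  (1 / 2 : ℝ) • x + (1 / 2 : ℝ) • p i

/-- The point with address `ω`, i.e. the single point of
`⋂ n, φ_{ω 0} ∘ ⋯ ∘ φ_{ω n} (K)`. -/
def addressPoint (p : Fin 3 → Plane) (ω : ℕ → Fin 3) : Plane :=
  ∑' k : ℕ, (1 / 2 : ℝ) ^ (k + 1) • p (ω k)

/-- The Sierpinski gasket with corners `p 0, p 1, p 2`: the set of all points that have an address.
By `gasketSet_nonempty`, `isCompact_gasketSet`, `gasketSet_eq_iUnion` and `gasketSet_unique` it is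
the unique nonempty compact set `K` with `K = ⋃ i, φᵢ(K)`. -/
def gasketSet (p : Fin 3 → Plane) : Set Plane := range (addressPoint p)

theorem addressPoint_bound (p : Fin 3 → Plane) (k : ℕ) (i : Fin 3) :
    ‖(1 / 2 : ℝ) ^ (k + 1) • p i‖ ≤ (1 / 2 : ℝ) ^ (k + 1) * ∑ j, ‖p j‖ := by
  rw [norm_smul, norm_pow, Real.norm_of_nonneg (by norm_num : (0 : ℝ) ≤ 1 / 2)]
  gcongr
  exact Finset.single_le_sum (f := fun j => ‖p j‖) (fun j _ => norm_nonneg _) (Finset.mem_univ i)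

theorem summable_bound (p : Fin 3 → Plane) :
    Summable fun k : ℕ => (1 / 2 : ℝ) ^ (k + 1) * ∑ j, ‖p j‖ :=
  ((summable_nat_add_iff 1).2 summable_geometric_two).mul_right _

theorem summable_address (p : Fin 3 → Plane) (ω : ℕ → Fin 3) :
    Summable fun k : ℕ => (1 / 2 : ℝ) ^ (k + 1) • p (ω k) :=
  (summable_bound p).of_norm_bounded fun k => addressPoint_bound p k (ω k)

theorem continuous_addressPoint (p : Fin 3 → Plane) : Continuous (addressPoint p) := by
  refine continuous_tsum (fun k => ?_) (summable_bound p)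
    (fun k ω => addressPoint_bound p k (ω k))
  have h : Continuous (p : Fin 3 → Plane) := continuous_of_discreteTopology
  exact Continuous.const_smul (h.comp (continuous_apply (A := fun _ => Fin 3) k)) ((1 / 2 : ℝ) ^ (k + 1))

theorem addressPoint_succ (p : Fin 3 → Plane) (ω : ℕ → Fin 3) :
    addressPoint p ω = contraction p (ω 0) (addressPoint p fun k => ω (k + 1)) := by
  unfold addressPoint contraction
  rw [(summable_address p ω).tsum_eq_zero_add, ← tsum_const_smul'', add_comm]
  simp [pow_succ, smul_smul, mul_comm]

theorem contraction_addressPoint (p : Fin 3 → Plane) (i : Fin 3) (ω : ℕ → Fin 3) :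
    contraction p i (addressPoint p ω) =
      addressPoint p (fun k => Nat.casesOn k i fun m => ω m) := by
  exact (addressPoint_succ p (fun k => Nat.casesOn k i fun m => ω m)).symm

theorem addressPoint_const (p : Fin 3 → Plane) (i : Fin 3) :
    addressPoint p (fun _ => i) = p i := by
  have h := addressPoint_succ p fun _ => i
  simp only [contraction] at h
  have h2 : (1 / 2 : ℝ) • addressPoint p (fun _ => i) = (1 / 2 : ℝ) • p i := by
    have h3 : (1 / 2 : ℝ) • addressPoint p (fun _ => i) =
        addressPoint p (fun _ => i) - (1 / 2 : ℝ) • addressPoint p (fun _ => i) := by module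
    rw [h3]
    nth_rewrite 1 [h]
    module
  exact smul_right_injective Plane (by norm_num : (1 / 2 : ℝ) ≠ 0) h2

theorem gasketSet_nonempty (p : Fin 3 → Plane) : (gasketSet p).Nonempty := range_nonempty _

theorem isCompact_gasketSet (p : Fin 3 → Plane) : IsCompact (gasketSet p) :=
  isCompact_range (continuous_addressPoint p)

theorem gasketSet_eq_iUnion (p : Fin 3 → Plane) :
    gasketSet p = ⋃ i, contraction p i '' gasketSet p := by
  ext x
  simp only [mem_iUnion, mem_image, gasketSet, mem_range]
  constructor
  · rintro ⟨ω, rfl⟩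
    exact ⟨ω 0, _, ⟨_, rfl⟩, (addressPoint_succ p ω).symm⟩
  · rintro ⟨i, _, ⟨ω, rfl⟩, rfl⟩
    exact ⟨_, (contraction_addressPoint p i ω).symm⟩

theorem dist_contraction (p : Fin 3 → Plane) (i : Fin 3) (x y : Plane) :
    dist (contraction p i x) (contraction p i y) = 1 / 2 * dist x y := by
  simp [contraction, dist_eq_norm, ← smul_sub, norm_smul]

theorem infDist_le_of_selfSimilar (p : Fin 3 → Plane) {K L : Set Plane} (hK : IsCompact K)
    (hL : IsCompact L) (hL0 : L.Nonempty) (hK1 : K = ⋃ i, contraction p i '' K)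
    (hL1 : L = ⋃ i, contraction p i '' L) : K ⊆ L := by
  rcases K.eq_empty_or_nonempty with rfl | hK0
  · exact empty_subset L
  obtain ⟨x, hx, hmax⟩ := hK.exists_isMaxOn hK0 (Metric.continuous_infDist_pt L).continuousOn
  have h0 : Metric.infDist x L ≤ 0 := by
    have hx' := hx
    rw [hK1] at hx'
    obtain ⟨i, z, hz, rfl⟩ := by simpa only [mem_iUnion, mem_image] using hx'
    obtain ⟨w, hw, hzw⟩ := hL.exists_infDist_eq_dist hL0 z
    have hwL : contraction p i w ∈ L := by
      rw [hL1]; exact mem_iUnion.2 ⟨i, mem_image_of_mem _ hw⟩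
    have h1 := Metric.infDist_le_dist_of_mem (x := contraction p i z) hwL
    rw [dist_contraction, ← hzw] at h1
    have h2 : Metric.infDist z L ≤ Metric.infDist (contraction p i z) L := hmax hz
    linarith
  intro y hy
  have h3 : Metric.infDist y L ≤ Metric.infDist x L := hmax hy
  have h4 : Metric.infDist y L = 0 := le_antisymm (h3.trans h0) Metric.infDist_nonneg
  exact (hL.isClosed.mem_iff_infDist_zero hL0).2 h4

theorem gasketSet_unique (p : Fin 3 → Plane) {K : Set Plane} (hK : IsCompact K)
    (hK0 : K.Nonempty) (hK1 : K = ⋃ i, contraction p i '' K) : K = gasketSet p :=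
  Subset.antisymm
    (infDist_le_of_selfSimilar p hK (isCompact_gasketSet p) (gasketSet_nonempty p) hK1
      (gasketSet_eq_iUnion p))
    (infDist_le_of_selfSimilar p (isCompact_gasketSet p) hK hK0 (gasketSet_eq_iUnion p) hK1)

/-- The gasket as a compact metric space, with its Borel `σ`-algebra. -/
abbrev Gasket (p : Fin 3 → Plane) : Type := gasketSet p

instance (p : Fin 3 → Plane) : CompactSpace (Gasket p) :=
  isCompact_iff_compactSpace.1 (isCompact_gasketSet p)

/-- The contraction `φᵢ` as a map of the gasket to itself. -/
def cellContraction (p : Fin 3 → Plane) (i : Fin 3) (x : Gasket p) : Gasket p :=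
  ⟨contraction p i x, by
    have h : contraction p i x ∈ ⋃ j, contraction p j '' gasketSet p :=
      mem_iUnion.2 ⟨i, mem_image_of_mem _ x.2⟩
    rwa [← gasketSet_eq_iUnion] at h⟩

/-- The map `φ_w = φ_{w₁} ∘ ⋯ ∘ φ_{wₙ}` of a word `w`. -/
def cellMap (p : Fin 3 → Plane) : List (Fin 3) → Gasket p → Gasket p
  | [], x => x
  | i :: w, x => cellContraction p i (cellMap p w x)

/-- The corners `p i` as points of the gasket. -/
def corner (p : Fin 3 → Plane) (i : Fin 3) : Gasket p :=
  ⟨p i, ⟨fun _ => i, addressPoint_const p i⟩⟩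

/-! ### Energy -/

/-- `(5/3)ⁿ ∑_{x ∼ₙ y} F x y`, the renormalized sum over the edges of the graph of level `n`.
The edges of level `n` are the pairs `{φ_w(pᵢ), φ_w(pⱼ)}`, `|w| = n`, `i < j`, and each edge comes
from exactly one such `(w, i, j)`. -/
def edgeSum (p : Fin 3 → Plane) {M : Type} [AddCommGroup M] [Module ℝ M] (n : ℕ)
    (F : Gasket p → Gasket p → M) : M :=
  (5 / 3 : ℝ) ^ n • ∑ w : Fin n → Fin 3, ∑ i : Fin 3, ∑ j ∈ Finset.Ioi i,
    F (cellMap p (List.ofFn w) (corner p i)) (cellMap p (List.ofFn w) (corner p j))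

section edgeSum

variable (p : Fin 3 → Plane) {M : Type} [AddCommGroup M] [Module ℝ M]

theorem edgeSum_zero (F : Gasket p → Gasket p → M) :
    edgeSum p 0 F = F (corner p 0) (corner p 1) + F (corner p 0) (corner p 2)
      + F (corner p 1) (corner p 2) := by
  have h0 : Finset.Ioi (0 : Fin 3) = {1, 2} := by decide
  have h1 : Finset.Ioi (1 : Fin 3) = {2} := by decide
  have h2 : Finset.Ioi (2 : Fin 3) = ∅ := by decide
  simp [edgeSum, Fin.sum_univ_three, h0, h1, h2, cellMap]

theorem edgeSum_succ (n : ℕ) (F : Gasket p → Gasket p → M) :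
    edgeSum p (n + 1) F = (5 / 3 : ℝ) • ∑ k : Fin 3,
      edgeSum p n fun x y => F (cellContraction p k x) (cellContraction p k y) := by
  unfold edgeSum
  rw [← Finset.smul_sum, smul_smul, ← pow_succ', ← (Fin.consEquiv fun _ => Fin 3).sum_comp,
    Fintype.sum_prod_type]
  simp [Fin.consEquiv, List.ofFn_succ, cellMap]

theorem edgeSum_add (n : ℕ) (F G : Gasket p → Gasket p → M) :
    edgeSum p n (fun x y => F x y + G x y) = edgeSum p n F + edgeSum p n G := by
  simp [edgeSum, Finset.sum_add_distrib]

theorem edgeSum_sub (n : ℕ) (F G : Gasket p → Gasket p → M) :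
    edgeSum p n (fun x y => F x y - G x y) = edgeSum p n F - edgeSum p n G := by
  simp [edgeSum, Finset.sum_sub_distrib, smul_sub]

theorem map_edgeSum {N : Type} [AddCommGroup N] [Module ℝ N] (T : M →ₗ[ℝ] N) (n : ℕ)
    (F : Gasket p → Gasket p → M) :
    T (edgeSum p n F) = edgeSum p n (fun x y => T (F x y)) := by
  simp [edgeSum, map_sum]

theorem ofReal_edgeSum (n : ℕ) (F : Gasket p → Gasket p → ℝ) :
    ((edgeSum p n F : ℝ) : ℂ) = edgeSum p n fun x y => ((F x y : ℝ) : ℂ) :=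
  map_edgeSum p Complex.ofRealCLM.toLinearMap n F

theorem re_edgeSum (n : ℕ) (F : Gasket p → Gasket p → ℂ) :
    (edgeSum p n F).re = edgeSum p n fun x y => (F x y).re :=
  map_edgeSum p Complex.reCLM.toLinearMap n F

theorem conj_edgeSum (n : ℕ) (F : Gasket p → Gasket p → ℂ) :
    conj (edgeSum p n F) = edgeSum p n fun x y => conj (F x y) :=
  map_edgeSum p Complex.conjLIE.toLinearEquiv.toLinearMap n F

theorem mul_edgeSum (n : ℕ) (c : ℂ) (F : Gasket p → Gasket p → ℂ) :
    c * edgeSum p n F = edgeSum p n fun x y => c * F x y :=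
  map_edgeSum p (LinearMap.mulLeft ℝ c) n F

theorem real_mul_edgeSum (n : ℕ) (c : ℝ) (F : Gasket p → Gasket p → ℝ) :
    c * edgeSum p n F = edgeSum p n fun x y => c * F x y :=
  map_edgeSum p (LinearMap.mulLeft ℝ c) n F

theorem edgeSum_mono (n : ℕ) {F G : Gasket p → Gasket p → ℝ} (h : ∀ x y, F x y ≤ G x y) :
    edgeSum p n F ≤ edgeSum p n G := by
  unfold edgeSum
  refine smul_le_smul_of_nonneg_left ?_ (by positivity)
  exact Finset.sum_le_sum fun _ _ => Finset.sum_le_sum fun _ _ => Finset.sum_le_sum fun _ _ => h _ _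

theorem edgeSum_nonneg (n : ℕ) {F : Gasket p → Gasket p → ℝ} (h : ∀ x y, 0 ≤ F x y) :
    0 ≤ edgeSum p n F := by
  refine le_of_eq_of_le ?_ (edgeSum_mono p n h)
  simp [edgeSum]

end edgeSum

/-- The discrete energy `Eₙ(u) = (5/3)ⁿ ∑_{x ∼ₙ y} |u(x) - u(y)|²`. -/
def discreteEnergy (p : Fin 3 → Plane) (n : ℕ) (u : Gasket p → ℂ) : ℝ :=
  edgeSum p n fun x y => ‖u x - u y‖ ^ 2

theorem discreteEnergy_nonneg (p : Fin 3 → Plane) (n : ℕ) (u : Gasket p → ℂ) :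
    0 ≤ discreteEnergy p n u := edgeSum_nonneg p n fun _ _ => by positivity

theorem cellContraction_corner_comm (p : Fin 3 → Plane) (i j : Fin 3) :
    cellContraction p i (corner p j) = cellContraction p j (corner p i) :=
  Subtype.ext (add_comm _ _)

theorem cellContraction_corner_self (p : Fin 3 → Plane) (i : Fin 3) :
    cellContraction p i (corner p i) = corner p i := by
  apply Subtype.ext
  simp [cellContraction, contraction, corner, ← add_smul]
  norm_num

theorem discreteEnergy_le_succ (p : Fin 3 → Plane) (n : ℕ) (u : Gasket p → ℂ) :
    discreteEnergy p n u ≤ discreteEnergy p (n + 1) u := by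
  induction n generalizing u with
  | zero =>
    rw [discreteEnergy, discreteEnergy, edgeSum_succ]
    simp only [edgeSum_zero, Fin.sum_univ_three, cellContraction_corner_self]
    rw [cellContraction_corner_comm p 1 0, cellContraction_corner_comm p 2 0,
      cellContraction_corner_comm p 2 1]
    generalize u (corner p 0) = a
    generalize u (corner p 1) = b
    generalize u (corner p 2) = c
    generalize u (cellContraction p 0 (corner p 1)) = z
    generalize u (cellContraction p 0 (corner p 2)) = y
    generalize u (cellContraction p 1 (corner p 2)) = x
    simp only [← Complex.normSq_eq_norm_sq, Complex.normSq_apply, Complex.sub_re, Complex.sub_im,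
      smul_eq_mul]
    have key : ∀ a b c x y z : ℝ, (a - b) * (a - b) + (a - c) * (a - c) + (b - c) * (b - c) ≤
        5 / 3 * (((a - z) * (a - z) + (a - y) * (a - y) + (z - y) * (z - y)) +
          ((z - b) * (z - b) + (z - x) * (z - x) + (b - x) * (b - x)) +
          ((y - x) * (y - x) + (y - c) * (y - c) + (x - c) * (x - c))) := by
      intro a b c x y z
      nlinarith [sq_nonneg (5 * x - 2 * b - 2 * c - a), sq_nonneg (5 * y - 2 * a - 2 * c - b),
        sq_nonneg (5 * z - 2 * a - 2 * b - c), sq_nonneg (5 * x - 5 * y - b + a),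
        sq_nonneg (5 * x - 5 * z - c + a), sq_nonneg (5 * y - 5 * z - c + b)]
    have h1 := key a.re b.re c.re x.re y.re z.re
    have h2 := key a.im b.im c.im x.im y.im z.im
    linarith
  | succ n ih =>
    rw [discreteEnergy, discreteEnergy, edgeSum_succ, edgeSum_succ p (n + 1)]
    refine smul_le_smul_of_nonneg_left (Finset.sum_le_sum fun k _ => ?_) (by norm_num)
    exact ih fun x => u (cellContraction p k x)

theorem monotone_discreteEnergy (p : Fin 3 → Plane) (u : Gasket p → ℂ) :
    Monotone fun n => discreteEnergy p n u :=
  monotone_nat_of_le_succ fun n => discreteEnergy_le_succ p n u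

theorem discreteEnergy_add_le (p : Fin 3 → Plane) (n : ℕ) (u v : Gasket p → ℂ) :
    discreteEnergy p n (fun x => u x + v x) ≤
      2 * discreteEnergy p n u + 2 * discreteEnergy p n v := by
  have h := edgeSum_mono p n (F := fun x y => ‖u x + v x - (u y + v y)‖ ^ 2)
    (G := fun x y => (‖u x - u y‖ ^ 2 + ‖u x - u y‖ ^ 2) + (‖v x - v y‖ ^ 2 + ‖v x - v y‖ ^ 2))
    (fun x y => by
      have h1 : ‖u x + v x - (u y + v y)‖ ≤ ‖u x - u y‖ + ‖v x - v y‖ := by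
        rw [add_sub_add_comm]; exact norm_add_le _ _
      nlinarith [sq_nonneg (‖u x - u y‖ - ‖v x - v y‖), norm_nonneg (u x + v x - (u y + v y))])
  rw [edgeSum_add, edgeSum_add, edgeSum_add] at h
  unfold discreteEnergy
  linarith

theorem discreteEnergy_mul_le (p : Fin 3 → Plane) (n : ℕ) (u v : C(Gasket p, ℂ)) :
    discreteEnergy p n (fun x => u x * v x) ≤
      2 * ‖v‖ ^ 2 * discreteEnergy p n u + 2 * ‖u‖ ^ 2 * discreteEnergy p n v := by
  have h := edgeSum_mono p n (F := fun x y => ‖u x * v x - u y * v y‖ ^ 2)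
    (G := fun x y => (2 * ‖v‖ ^ 2) * ‖u x - u y‖ ^ 2 + (2 * ‖u‖ ^ 2) * ‖v x - v y‖ ^ 2)
    (fun x y => by
      have h1 : ‖u x * v x - u y * v y‖ ≤ ‖v‖ * ‖u x - u y‖ + ‖u‖ * ‖v x - v y‖ := by
        have : u x * v x - u y * v y = (u x - u y) * v x + u y * (v x - v y) := by ring
        rw [this]
        refine (norm_add_le _ _).trans ?_
        rw [norm_mul, norm_mul, mul_comm ‖u x - u y‖]
        gcongr
        · exact v.norm_coe_le_norm x
        · exact u.norm_coe_le_norm y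
      nlinarith [sq_nonneg (‖v‖ * ‖u x - u y‖ - ‖u‖ * ‖v x - v y‖),
        norm_nonneg (u x * v x - u y * v y)])
  rw [edgeSum_add] at h
  rw [← real_mul_edgeSum, ← real_mul_edgeSum] at h
  exact h

theorem discreteEnergy_const (p : Fin 3 → Plane) (n : ℕ) (c : ℂ) :
    discreteEnergy p n (fun _ => c) = 0 := by simp [discreteEnergy, edgeSum]

theorem discreteEnergy_star (p : Fin 3 → Plane) (n : ℕ) (u : Gasket p → ℂ) :
    discreteEnergy p n (fun x => star (u x)) = discreteEnergy p n u := by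
  simp only [discreteEnergy, ← star_sub, norm_star]

/-- The space `𝓕_ℂ = 𝓕 + i𝓕` of continuous functions of finite energy: the functions `u` for which
the increasing sequence `Eₙ(u)` is bounded. It is a conjugation invariant subalgebra of `C(K, ℂ)`;
its real valued members form `𝓕`. -/
def FC (p : Fin 3 → Plane) : StarSubalgebra ℂ C(Gasket p, ℂ) where
  carrier := {u | BddAbove (range fun n => discreteEnergy p n u)}
  mul_mem' := by
    rintro u v ⟨a, ha⟩ ⟨b, hb⟩
    refine ⟨2 * ‖v‖ ^ 2 * a + 2 * ‖u‖ ^ 2 * b, ?_⟩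
    rintro _ ⟨n, rfl⟩
    refine (discreteEnergy_mul_le p n u v).trans ?_
    gcongr
    · exact ha ⟨n, rfl⟩
    · exact hb ⟨n, rfl⟩
  add_mem' := by
    rintro u v ⟨a, ha⟩ ⟨b, hb⟩
    refine ⟨2 * a + 2 * b, ?_⟩
    rintro _ ⟨n, rfl⟩
    refine (discreteEnergy_add_le p n u v).trans ?_
    gcongr
    · exact ha ⟨n, rfl⟩
    · exact hb ⟨n, rfl⟩
  algebraMap_mem' c := ⟨0, by
    rintro _ ⟨n, rfl⟩
    exact (discreteEnergy_const p n c).le⟩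
  star_mem' := by
    rintro u ⟨a, ha⟩
    refine ⟨a, ?_⟩
    rintro _ ⟨n, rfl⟩
    exact (discreteEnergy_star p n u).le.trans (ha ⟨n, rfl⟩)

/-- The energy form `𝓔(f, g) = limₙ (5/3)ⁿ ∑_{x ∼ₙ y} (f(x) - f(y)) conj(g(x) - g(y))` on `𝓕_ℂ`,
linear in the first and conjugate linear in the second argument. -/
def energyForm {p : Fin 3 → Plane} (f g : FC p) : ℂ :=
  limUnder atTop fun n => edgeSum p n fun x y => (f.1 x - f.1 y) * conj (g.1 x - g.1 y)

/-- The energy `𝓔(f) = limₙ Eₙ(f)`. -/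
def energy {p : Fin 3 → Plane} (f : FC p) : ℝ :=
  limUnder atTop fun n => discreteEnergy p n f.1

theorem tendsto_energy {p : Fin 3 → Plane} (f : FC p) :
    Tendsto (fun n => discreteEnergy p n f.1) atTop (𝓝 (energy f)) :=
  tendsto_nhds_limUnder ⟨_, tendsto_atTop_ciSup (monotone_discreteEnergy p f.1) f.2⟩

theorem discreteEnergy_le_energy {p : Fin 3 → Plane} (f : FC p) (n : ℕ) :
    discreteEnergy p n f.1 ≤ energy f :=
  (monotone_discreteEnergy p f.1).ge_of_tendsto (tendsto_energy f) n

theorem energy_nonneg {p : Fin 3 → Plane} (f : FC p) : 0 ≤ energy f :=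
  (discreteEnergy_nonneg p 0 f.1).trans (discreteEnergy_le_energy f 0)

/-! ### Energy measures -/

theorem dist_cellMap (p : Fin 3 → Plane) (w : List (Fin 3)) (x y : Gasket p) :
    dist (cellMap p w x) (cellMap p w y) = (1 / 2 : ℝ) ^ w.length * dist x y := by
  induction w with
  | nil => simp [cellMap]
  | cons i w ih =>
    have h := dist_contraction p i (cellMap p w x) (cellMap p w y)
    change dist (cellMap p w x) (cellMap p w y) = _ at ih
    rw [← Subtype.dist_eq, ih] at h
    simp only [cellMap, List.length_cons, pow_succ']
    rw [mul_assoc, ← h]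
    rfl

theorem exists_osc_le (p : Fin 3 → Plane) (φ : C(Gasket p, ℝ)) {ε : ℝ} (hε : 0 < ε) :
    ∃ N : ℕ, ∀ w : List (Fin 3), N ≤ w.length → ∀ x y,
      |φ (cellMap p w x) - φ (cellMap p w y)| ≤ ε := by
  obtain ⟨δ, hδ, h⟩ := Metric.uniformContinuous_iff.1
    (CompactSpace.uniformContinuous_of_continuous φ.continuous) ε hε
  have hlim : Tendsto (fun n : ℕ => (1 / 2 : ℝ) ^ n * Metric.diam (univ : Set (Gasket p)))
      atTop (𝓝 0) := by
    simpa using (tendsto_pow_atTop_nhds_zero_of_lt_one (by norm_num : (0 : ℝ) ≤ 1 / 2)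
      (by norm_num)).mul_const (Metric.diam (univ : Set (Gasket p)))
  obtain ⟨N, hN⟩ := (hlim.eventually_lt_const hδ).exists
  refine ⟨N, fun w hw x y => ?_⟩
  have h1 : dist (cellMap p w x) (cellMap p w y) < δ := by
    rw [dist_cellMap]
    refine lt_of_le_of_lt ?_ hN
    refine mul_le_mul (pow_le_pow_of_le_one (by norm_num) (by norm_num) hw)
      (Metric.dist_le_diam_of_mem isCompact_univ.isBounded (mem_univ _) (mem_univ _))
      dist_nonneg (by positivity)
  exact (Real.dist_eq _ _ ▸ h h1).le

/-- `(5/3)ⁿ ∑_{x ∼ₙ y} (φ(x) + φ(y))/2 · |f(x) - f(y)|²`, the integral of `φ` with respect to the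
discrete energy measure of level `n` of `f`, in which each edge splits its energy evenly between
its two end points. -/
def discreteIntegral (p : Fin 3 → Plane) (n : ℕ) (f : Gasket p → ℂ) (φ : Gasket p → ℝ) : ℝ :=
  edgeSum p n fun x y => (φ x + φ y) / 2 * ‖f x - f y‖ ^ 2

theorem discreteIntegral_sub_le (p : Fin 3 → Plane) (k : ℕ) (f : Gasket p → ℂ)
    (φ : Gasket p → ℝ) (c ε : ℝ) (h : ∀ x, |φ x - c| ≤ ε) :
    |discreteIntegral p k f φ - c * discreteEnergy p k f| ≤ ε * discreteEnergy p k f := by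
  have hm : ∀ r : ℝ, r * discreteEnergy p k f = edgeSum p k fun x y => r * ‖f x - f y‖ ^ 2 :=
    fun r => real_mul_edgeSum p k r fun x y => ‖f x - f y‖ ^ 2
  have h1 : discreteIntegral p k f φ ≤ (c + ε) * discreteEnergy p k f := by
    rw [hm]
    refine edgeSum_mono p k fun x y => ?_
    have hx := abs_le.1 (h x)
    have hy := abs_le.1 (h y)
    exact mul_le_mul_of_nonneg_right (by linarith) (by positivity)
  have h2 : (c - ε) * discreteEnergy p k f ≤ discreteIntegral p k f φ := by
    rw [hm]
    refine edgeSum_mono p k fun x y => ?_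
    have hx := abs_le.1 (h x)
    have hy := abs_le.1 (h y)
    exact mul_le_mul_of_nonneg_right (by linarith) (by positivity)
  rw [abs_le]
  constructor <;> linarith

theorem discreteIntegral_step (p : Fin 3 → Plane) (n k : ℕ) (f : Gasket p → ℂ)
    (φ : Gasket p → ℝ) (M ε : ℝ) (hM : ∀ x, |φ x| ≤ M)
    (h : ∀ w : List (Fin 3), w.length = n → ∀ x y, |φ (cellMap p w x) - φ (cellMap p w y)| ≤ ε) :
    |discreteIntegral p (n + k) f φ - discreteIntegral p n f φ| ≤
      M * (discreteEnergy p (n + k) f - discreteEnergy p n f) +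
        ε * (discreteEnergy p (n + k) f + discreteEnergy p n f) := by
  induction n generalizing f φ with
  | zero =>
    have hε : ∀ x, |φ x - φ (corner p 0)| ≤ ε := fun x => h [] rfl x (corner p 0)
    have h1 := abs_le.1 (discreteIntegral_sub_le p (0 + k) f φ _ ε hε)
    have h2 := abs_le.1 (discreteIntegral_sub_le p 0 f φ _ ε hε)
    have h3 := monotone_discreteEnergy p f (Nat.zero_le (0 + k))
    have h4 := abs_le.1 (hM (corner p 0))
    simp only at h3
    rw [abs_le]
    constructor <;> nlinarith
  | succ n ih =>
    have hs : ∀ m, discreteIntegral p (m + 1) f φ = (5 / 3 : ℝ) * ∑ i : Fin 3,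
        discreteIntegral p m (fun x => f (cellContraction p i x))
          (fun x => φ (cellContraction p i x)) := fun m => edgeSum_succ p m _
    have he : ∀ m, discreteEnergy p (m + 1) f = (5 / 3 : ℝ) * ∑ i : Fin 3,
        discreteEnergy p m (fun x => f (cellContraction p i x)) := fun m => edgeSum_succ p m _
    have hi := fun i : Fin 3 => abs_le.1 (ih (fun x => f (cellContraction p i x))
      (fun x => φ (cellContraction p i x)) (fun x => hM _)
      (fun w hw x y => h (i :: w) (by simp [hw]) x y))
    rw [Nat.add_right_comm, hs, hs, he, he]
    simp only [Fin.sum_univ_three]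
    have h0 := hi 0
    have h1 := hi 1
    have h2 := hi 2
    rw [abs_le]
    constructor <;> linarith

theorem exists_tendsto_discreteIntegral {p : Fin 3 → Plane} (f : FC p) (φ : C(Gasket p, ℝ)) :
    ∃ l, Tendsto (fun n => discreteIntegral p n f.1 φ) atTop (𝓝 l) := by
  apply cauchySeq_tendsto_of_complete
  rw [Metric.cauchySeq_iff']
  intro ε hε
  have hE := energy_nonneg f
  obtain ⟨N₁, hN₁⟩ := exists_osc_le p φ (ε := ε / (4 * (energy f + 1))) (by positivity)
  obtain ⟨N₂, hN₂⟩ := ((tendsto_order.1 (tendsto_energy f)).1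
    (energy f - ε / (4 * (‖φ‖ + 1))) (by linarith [show 0 < ε / (4 * (‖φ‖ + 1)) by positivity])).exists
  refine ⟨max N₁ N₂, fun m hm => ?_⟩
  obtain ⟨k, rfl⟩ := Nat.exists_eq_add_of_le hm
  have h := discreteIntegral_step p (max N₁ N₂) k f.1 φ ‖φ‖ _ (fun x => φ.norm_coe_le_norm x)
    (fun w hw => hN₁ w (hw ▸ le_max_left _ _))
  rw [Real.dist_eq]
  refine h.trans_lt ?_
  have h1 := discreteEnergy_le_energy f (max N₁ N₂ + k)
  have h2 := discreteEnergy_le_energy f (max N₁ N₂)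
  have h3 := monotone_discreteEnergy p f.1 (le_max_right N₁ N₂)
  simp only at h3
  have a1 : ‖φ‖ * (discreteEnergy p (max N₁ N₂ + k) f.1 - discreteEnergy p (max N₁ N₂) f.1) ≤
      (‖φ‖ + 1) * (ε / (4 * (‖φ‖ + 1))) :=
    (mul_le_mul_of_nonneg_left (by linarith) (norm_nonneg φ)).trans
      (mul_le_mul_of_nonneg_right (by linarith) (by positivity))
  have a2 : ε / (4 * (energy f + 1)) *
      (discreteEnergy p (max N₁ N₂ + k) f.1 + discreteEnergy p (max N₁ N₂) f.1) ≤
      ε / (4 * (energy f + 1)) * (2 * (energy f + 1)) :=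
    mul_le_mul_of_nonneg_left (by linarith) (by positivity)
  have a3 : (‖φ‖ + 1) * (ε / (4 * (‖φ‖ + 1))) = ε / 4 := by
    have : ‖φ‖ + 1 ≠ 0 := by positivity
    field_simp
  have a4 : ε / (4 * (energy f + 1)) * (2 * (energy f + 1)) = ε / 2 := by
    have : energy f + 1 ≠ 0 := by positivity
    field_simp; norm_num
  linarith

theorem tendsto_discreteIntegral {p : Fin 3 → Plane} (f : FC p) (φ : C(Gasket p, ℝ)) :
    Tendsto (fun n => discreteIntegral p n f.1 φ) atTop
      (𝓝 (limUnder atTop fun n => discreteIntegral p n f.1 φ)) :=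
  tendsto_nhds_limUnder (exists_tendsto_discreteIntegral f φ)

/-- The positive functional `φ ↦ limₙ (5/3)ⁿ ∑_{x ∼ₙ y} (φ(x) + φ(y))/2 · |f(x) - f(y)|²` on the
continuous functions. -/
def energyFunctional {p : Fin 3 → Plane} (f : FC p) :
    CompactlySupportedContinuousMap (Gasket p) ℝ →ₚ[ℝ] ℝ :=
  PositiveLinearMap.mk₀
    { toFun := fun φ => limUnder atTop fun n => discreteIntegral p n f.1 φ
      map_add' := by
        intro φ ψ
        refine Tendsto.limUnder_eq ?_
        refine ((tendsto_discreteIntegral f φ.toContinuousMap).add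
          (tendsto_discreteIntegral f ψ.toContinuousMap)).congr fun n => ?_
        rw [discreteIntegral, discreteIntegral, ← edgeSum_add]
        refine congrArg (edgeSum p n) ?_
        funext x y
        simp only [CompactlySupportedContinuousMap.coe_add, Pi.add_apply,
          CompactlySupportedContinuousMap.coe_toContinuousMap]
        ring
      map_smul' := by
        intro c φ
        refine Tendsto.limUnder_eq ?_
        refine ((tendsto_discreteIntegral f φ.toContinuousMap).const_mul c).congr fun n => ?_
        refine (real_mul_edgeSum p n c _).trans ?_
        refine congrArg (edgeSum p n) ?_
        funext x y
        simp only [CompactlySupportedContinuousMap.coe_smul, Pi.smul_apply,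
          CompactlySupportedContinuousMap.coe_toContinuousMap, smul_eq_mul]
        ring }
    (by
      intro φ hφ
      refine ge_of_tendsto' (tendsto_discreteIntegral f φ.toContinuousMap) fun n => ?_
      refine edgeSum_nonneg p n fun x y => ?_
      have hx : 0 ≤ φ x := hφ x
      have hy : 0 ≤ φ y := hφ y
      exact mul_nonneg (by simpa using (by linarith : 0 ≤ (φ x + φ y) / 2)) (by positivity))

/-- The energy measure `ν_f` of `f ∈ 𝓕_ℂ`: the Borel measure on `K` that represents
`energyFunctional f`, i.e. the weak limit of the discrete energy measures. -/
def energyMeasure {p : Fin 3 → Plane} (f : FC p) : Measure (Gasket p) :=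
  RealRMK.rieszMeasure (energyFunctional f)

instance {p : Fin 3 → Plane} (f : FC p) : IsFiniteMeasure (energyMeasure f) :=
  inferInstanceAs (IsFiniteMeasure (RealRMK.rieszMeasure (energyFunctional f)))

theorem tendsto_integral_energyMeasure {p : Fin 3 → Plane} (f : FC p) (φ : C(Gasket p, ℝ)) :
    Tendsto (fun n => discreteIntegral p n f.1 φ) atTop (𝓝 (∫ x, φ x ∂energyMeasure f)) := by
  have h := RealRMK.integral_rieszMeasure (energyFunctional f)
    (CompactlySupportedContinuousMap.continuousMapEquiv φ)
  have h2 : ∫ x, φ x ∂energyMeasure f = limUnder atTop fun n => discreteIntegral p n f.1 φ := h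
  rw [h2]
  exact tendsto_discreteIntegral f φ

/-- `∫ φ dν_{f,g}` for the (complex) mutual energy measure
`ν_{f,g} = (ν_{f+g} - ν_{f-g} + i ν_{f+ig} - i ν_{f-ig}) / 4` of `f, g ∈ 𝓕_ℂ`. -/
def mutualIntegral {p : Fin 3 → Plane} (f g : FC p) (φ : Gasket p → ℂ) : ℂ :=
  (1 / 4 : ℂ) * ∑ k : Fin 4,
    Complex.I ^ (k : ℕ) * ∫ x, φ x ∂energyMeasure (f + Complex.I ^ (k : ℕ) • g)

theorem tendsto_integral_complex {p : Fin 3 → Plane} (f : FC p) (φ : C(Gasket p, ℂ)) :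
    Tendsto (fun n => edgeSum p n fun x y => (φ x + φ y) / 2 * ((‖f.1 x - f.1 y‖ ^ 2 : ℝ) : ℂ))
      atTop (𝓝 (∫ x, φ x ∂energyMeasure f)) := by
  have hint : Integrable (fun x => φ x) (energyMeasure f) :=
    φ.continuous.integrable_of_hasCompactSupport (HasCompactSupport.of_compactSpace _)
  have h1 := tendsto_integral_energyMeasure f ⟨fun x => (φ x).re, by fun_prop⟩
  have h2 := tendsto_integral_energyMeasure f ⟨fun x => (φ x).im, by fun_prop⟩
  have e : ∫ x, φ x ∂energyMeasure f =
      ((∫ x, (φ x).re ∂energyMeasure f : ℝ) : ℂ) + ((∫ x, (φ x).im ∂energyMeasure f : ℝ) : ℂ) *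
        Complex.I := (integral_re_add_im hint).symm
  rw [e]
  refine (((Complex.continuous_ofReal.tendsto _).comp h1).add
    (((Complex.continuous_ofReal.tendsto _).comp h2).mul_const Complex.I)).congr fun n => ?_
  simp only [Function.comp_apply, discreteIntegral]
  rw [ofReal_edgeSum, ofReal_edgeSum, mul_comm, mul_edgeSum, ← edgeSum_add]
  refine congrArg (edgeSum p n) (funext fun x => funext fun y => ?_)
  generalize ‖f.1 x - f.1 y‖ ^ 2 = r
  apply Complex.ext <;> simp

theorem tendsto_mutualIntegral {p : Fin 3 → Plane} (f g : FC p) (φ : C(Gasket p, ℂ)) :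
    Tendsto (fun n => edgeSum p n fun x y =>
        (φ x + φ y) / 2 * ((f.1 x - f.1 y) * conj (g.1 x - g.1 y)))
      atTop (𝓝 (mutualIntegral f g φ)) := by
  have h := (tendsto_finsetSum (Finset.univ : Finset (Fin 4)) fun k _ =>
    (tendsto_integral_complex (f + Complex.I ^ (k : ℕ) • g) φ).const_mul
      (Complex.I ^ (k : ℕ))).const_mul (1 / 4 : ℂ)
  refine h.congr fun n => ?_
  simp only [Fin.sum_univ_four, mul_edgeSum, ← edgeSum_add]
  refine congrArg (edgeSum p n) ?_
  funext x y
  have hadd : ∀ (u v : FC p) (z : Gasket p), (u + v).1 z = u.1 z + v.1 z := fun _ _ _ => rfl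
  have hsmul : ∀ (c : ℂ) (v : FC p) (z : Gasket p), (c • v).1 z = c * v.1 z := fun _ _ _ => rfl
  simp only [hadd, hsmul]
  generalize f.1 x = a
  generalize f.1 y = b
  generalize g.1 x = c
  generalize g.1 y = d
  generalize φ x = s
  generalize φ y = t
  simp only [Complex.sq_norm]
  apply Complex.ext <;> simp [Complex.normSq_apply, pow_succ] <;> ring

theorem tendsto_energyForm {p : Fin 3 → Plane} (f g : FC p) :
    Tendsto (fun n => edgeSum p n fun x y => (f.1 x - f.1 y) * conj (g.1 x - g.1 y))
      atTop (𝓝 (energyForm f g)) := by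
  refine tendsto_nhds_limUnder ⟨mutualIntegral f g (1 : C(Gasket p, ℂ)), ?_⟩
  refine (tendsto_mutualIntegral f g 1).congr fun n => ?_
  simp

theorem energyForm_self {p : Fin 3 → Plane} (f : FC p) : energyForm f f = (energy f : ℂ) := by
  refine tendsto_nhds_unique (tendsto_energyForm f f) ?_
  refine ((Complex.continuous_ofReal.tendsto _).comp (tendsto_energy f)).congr fun n => ?_
  simp only [Function.comp_apply, discreteEnergy]
  rw [ofReal_edgeSum]
  refine congrArg (edgeSum p n) (funext fun x => funext fun y => ?_)
  rw [Complex.mul_conj, Complex.normSq_eq_norm_sq]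

/-- The measures `ν_f` are the usual energy measures: they are given by
`∫ φ dν_f = 𝓔(φ f, f) - 𝓔(φ, |f|²) / 2` for real valued `φ ∈ 𝓕` (for complex valued `f` one has to
take real parts). -/
theorem integral_energyMeasure_eq {p : Fin 3 → Plane} (f φ : FC p)
    (hφ : ∀ x, conj (φ.1 x) = φ.1 x) :
    ∫ x, (φ.1 x).re ∂energyMeasure f =
      (energyForm (φ * f) f - energyForm φ (f * star f) / 2).re := by
  refine tendsto_nhds_unique
    (tendsto_integral_energyMeasure f ⟨fun x => (φ.1 x).re, by fun_prop⟩) ?_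
  have h := (Complex.continuous_re.tendsto _).comp
    ((tendsto_energyForm (φ * f) f).sub ((tendsto_energyForm φ (f * star f)).const_mul (1 / 2 : ℂ)))
  rw [one_div_mul_eq_div] at h
  refine h.congr fun n => ?_
  simp only [Function.comp_apply, mul_edgeSum, ← edgeSum_sub, re_edgeSum, discreteIntegral]
  refine congrArg (edgeSum p n) (funext fun x => funext fun y => ?_)
  have hmul : ∀ (u v : FC p) (z : Gasket p), (u * v).1 z = u.1 z * v.1 z := fun _ _ _ => rfl
  have hstar : ∀ (u : FC p) (z : Gasket p), (star u).1 z = conj (u.1 z) := fun _ _ => rfl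
  have hx := Complex.conj_eq_iff_im.1 (hφ x)
  have hy := Complex.conj_eq_iff_im.1 (hφ y)
  simp only [hmul, hstar, Complex.sq_norm, Complex.normSq_apply, ContinuousMap.coe_mk]
  generalize f.1 x = a
  generalize f.1 y = b
  generalize φ.1 x = s at *
  generalize φ.1 y = t at *
  simp [hx, hy]
  ring

/-! ### One-forms -/

/-- The algebraic tensor product `𝓕_ℂ ⊗ 𝓕_ℂ`. -/
def PreForm (p : Fin 3 → Plane) : Type := FC p ⊗[ℂ] FC p

instance (p : Fin 3 → Plane) : AddCommGroup (PreForm p) :=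
  inferInstanceAs (AddCommGroup (FC p ⊗[ℂ] FC p))

instance (p : Fin 3 → Plane) : Module ℂ (PreForm p) :=
  inferInstanceAs (Module ℂ (FC p ⊗[ℂ] FC p))

/-- The elementary tensor `a ⊗ b`. -/
def PreForm.mk {p : Fin 3 → Plane} (a b : FC p) : PreForm p := a ⊗ₜ[ℂ] b

theorem PreForm.induction {p : Fin 3 → Plane} {P : PreForm p → Prop} (s : PreForm p)
    (zero : P 0) (mk : ∀ a b, P (.mk a b)) (add : ∀ s t, P s → P t → P (s + t)) : P s :=
  TensorProduct.induction_on s zero mk add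

theorem mutualIntegral_eq_lim {p : Fin 3 → Plane} {f g : FC p} {φ : C(Gasket p, ℂ)} {l : ℂ}
    (h : Tendsto (fun n => edgeSum p n fun x y =>
        (φ x + φ y) / 2 * ((f.1 x - f.1 y) * conj (g.1 x - g.1 y))) atTop (𝓝 l)) :
    mutualIntegral f g φ = l :=
  tendsto_nhds_unique (tendsto_mutualIntegral f g φ) h

theorem mutualIntegral_congr_add {p : Fin 3 → Plane} {f g f₁ g₁ f₂ g₂ : FC p}
    {φ φ₁ φ₂ : C(Gasket p, ℂ)}
    (h : ∀ x y, (φ x + φ y) / 2 * ((f.1 x - f.1 y) * conj (g.1 x - g.1 y)) =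
      (φ₁ x + φ₁ y) / 2 * ((f₁.1 x - f₁.1 y) * conj (g₁.1 x - g₁.1 y)) +
      (φ₂ x + φ₂ y) / 2 * ((f₂.1 x - f₂.1 y) * conj (g₂.1 x - g₂.1 y))) :
    mutualIntegral f g φ = mutualIntegral f₁ g₁ φ₁ + mutualIntegral f₂ g₂ φ₂ := by
  refine mutualIntegral_eq_lim (((tendsto_mutualIntegral f₁ g₁ φ₁).add
    (tendsto_mutualIntegral f₂ g₂ φ₂)).congr fun n => ?_)
  rw [← edgeSum_add]
  exact congrArg (edgeSum p n) (funext fun x => funext fun y => (h x y).symm)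

theorem mutualIntegral_congr_smul {p : Fin 3 → Plane} {f g f₁ g₁ : FC p}
    {φ φ₁ : C(Gasket p, ℂ)} {c : ℂ}
    (h : ∀ x y, (φ x + φ y) / 2 * ((f.1 x - f.1 y) * conj (g.1 x - g.1 y)) =
      c * ((φ₁ x + φ₁ y) / 2 * ((f₁.1 x - f₁.1 y) * conj (g₁.1 x - g₁.1 y)))) :
    mutualIntegral f g φ = c * mutualIntegral f₁ g₁ φ₁ := by
  refine mutualIntegral_eq_lim (((tendsto_mutualIntegral f₁ g₁ φ₁).const_mul c).congr fun n => ?_)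
  refine (mul_edgeSum p n c _).trans ?_
  exact congrArg (edgeSum p n) (funext fun x => funext fun y => (h x y).symm)

/-- The sesquilinear form on `𝓕_ℂ ⊗ 𝓕_ℂ`, linear in the first and conjugate linear in the second
argument, with `⟨a ⊗ b, c ⊗ d⟩ = ∫ b conj(d) dν_{a,c}` (equivalently `∫ b conj(d) Γ(a, c) dν`, where
`Γ(a, c)` is the density of `ν_{a,c}` with respect to the Kusuoka measure `ν`). -/
def preInner (p : Fin 3 → Plane) : PreForm p →ₗ[ℂ] PreForm p →ₗ⋆[ℂ] ℂ :=
  TensorProduct.lift (LinearMap.mk₂ ℂ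
    (fun a b => (TensorProduct.lift (LinearMap.mk₂'ₛₗ (starRingEnd ℂ) (starRingEnd ℂ)
      (fun c d => mutualIntegral a c fun x => b.1 x * conj (d.1 x))
      (fun c₁ c₂ d => mutualIntegral_congr_add (φ := b.1 * star d.1) (φ₁ := b.1 * star d.1)
        (φ₂ := b.1 * star d.1) fun x y => by simp; ring)
      (fun r c d => mutualIntegral_congr_smul (φ := b.1 * star d.1) (φ₁ := b.1 * star d.1)
        fun x y => by simp; ring)
      (fun c d₁ d₂ => mutualIntegral_congr_add (φ := b.1 * star (d₁ + d₂).1)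
        (φ₁ := b.1 * star d₁.1) (φ₂ := b.1 * star d₂.1) fun x y => by simp; ring)
      (fun r c d => mutualIntegral_congr_smul (φ := b.1 * star (r • d).1)
        (φ₁ := b.1 * star d.1) fun x y => by simp; ring)) : PreForm p →ₗ⋆[ℂ] ℂ))
    (fun a₁ a₂ b => TensorProduct.ext' fun c d =>
      mutualIntegral_congr_add (φ := b.1 * star d.1) (φ₁ := b.1 * star d.1)
        (φ₂ := b.1 * star d.1) fun x y => by simp; ring)
    (fun r a b => TensorProduct.ext' fun c d =>
      mutualIntegral_congr_smul (φ := b.1 * star d.1) (φ₁ := b.1 * star d.1)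
        fun x y => by simp; ring)
    (fun a b₁ b₂ => TensorProduct.ext' fun c d =>
      mutualIntegral_congr_add (φ := (b₁ + b₂).1 * star d.1)
        (φ₁ := b₁.1 * star d.1) (φ₂ := b₂.1 * star d.1) fun x y => by simp; ring)
    (fun r a b => TensorProduct.ext' fun c d =>
      mutualIntegral_congr_smul (φ := (r • b).1 * star d.1)
        (φ₁ := b.1 * star d.1) fun x y => by simp; ring))

theorem preInner_mk {p : Fin 3 → Plane} (a b c d : FC p) :
    preInner p (.mk a b) (.mk c d) = mutualIntegral a c fun x => b.1 x * conj (d.1 x) := rfl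

/-- The value of a tensor on the oriented edge `(x, y)`: `a ⊗ b ↦ b(x) (a(x) - a(y))`. -/
def edgeValue (p : Fin 3 → Plane) (x y : Gasket p) : PreForm p →ₗ[ℂ] ℂ :=
  TensorProduct.lift (LinearMap.mk₂ ℂ (fun a b => b.1 x * (a.1 x - a.1 y))
    (fun a₁ a₂ b => by simp; ring) (fun r a b => by simp; ring)
    (fun a b₁ b₂ => by simp; ring) (fun r a b => by simp; ring))

theorem edgeValue_mk {p : Fin 3 → Plane} (x y : Gasket p) (a b : FC p) :
    edgeValue p x y (.mk a b) = b.1 x * (a.1 x - a.1 y) := rfl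

theorem tendsto_preInner {p : Fin 3 → Plane} (s t : PreForm p) :
    Tendsto (fun n => edgeSum p n fun x y =>
        (edgeValue p x y s * conj (edgeValue p x y t) +
          edgeValue p y x s * conj (edgeValue p y x t)) / 2)
      atTop (𝓝 (preInner p s t)) := by
  have hadd : ∀ s₁ s₂ t₁ t₂ s₃ t₃ : PreForm p, ∀ l₁ l₂ l₃ : ℂ, 
      (∀ x y, edgeValue p x y s₃ * conj (edgeValue p x y t₃) =
        edgeValue p x y s₁ * conj (edgeValue p x y t₁) +
        edgeValue p x y s₂ * conj (edgeValue p x y t₂)) → l₃ = l₁ + l₂ →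
      Tendsto (fun n => edgeSum p n fun x y =>
        (edgeValue p x y s₁ * conj (edgeValue p x y t₁) +
          edgeValue p y x s₁ * conj (edgeValue p y x t₁)) / 2) atTop (𝓝 l₁) →
      Tendsto (fun n => edgeSum p n fun x y =>
        (edgeValue p x y s₂ * conj (edgeValue p x y t₂) +
          edgeValue p y x s₂ * conj (edgeValue p y x t₂)) / 2) atTop (𝓝 l₂) →
      Tendsto (fun n => edgeSum p n fun x y =>
        (edgeValue p x y s₃ * conj (edgeValue p x y t₃) +
          edgeValue p y x s₃ * conj (edgeValue p y x t₃)) / 2) atTop (𝓝 l₃) := by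
    intro s₁ s₂ t₁ t₂ s₃ t₃ l₁ l₂ l₃ he hl h1 h2
    rw [hl]
    refine (h1.add h2).congr fun n => ?_
    rw [← edgeSum_add]
    refine congrArg (edgeSum p n) (funext fun x => funext fun y => ?_)
    rw [he x y, he y x]
    ring
  induction s using PreForm.induction with
  | zero =>
    simp only [map_zero, zero_mul, add_zero, zero_div, LinearMap.zero_apply]
    simp [edgeSum]
  | mk a b =>
    induction t using PreForm.induction with
    | zero =>
      simp only [map_zero, mul_zero, add_zero, zero_div]
      simp [edgeSum]
    | mk c d =>
      refine (tendsto_mutualIntegral a c (b.1 * star d.1)).congr fun n => ?_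
      refine congrArg (edgeSum p n) (funext fun x => funext fun y => ?_)
      simp only [edgeValue_mk]
      simp
      ring
    | add t₁ t₂ h1 h2 =>
      exact hadd _ _ _ _ _ _ _ _ _ (fun x y => by rw [map_add, map_add]; ring)
        (map_add _ _ _) h1 h2
  | add s₁ s₂ h1 h2 =>
    exact hadd _ _ _ _ _ _ _ _ _ (fun x y => by rw [map_add]; ring)
        (by rw [map_add]; rfl) h1 h2

/-- Real valued version for the diagonal. -/
theorem tendsto_preInner_self {p : Fin 3 → Plane} (s : PreForm p) :
    Tendsto (fun n => edgeSum p n fun x y =>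
        (‖edgeValue p x y s‖ ^ 2 + ‖edgeValue p y x s‖ ^ 2) / 2)
      atTop (𝓝 (preInner p s s).re) := by
  refine ((Complex.continuous_re.tendsto _).comp (tendsto_preInner s s)).congr fun n => ?_
  simp only [Function.comp_apply, re_edgeSum]
  refine congrArg (edgeSum p n) (funext fun x => funext fun y => ?_)
  simp only [Complex.mul_conj, Complex.normSq_eq_norm_sq]
  norm_cast

/-- The positive semidefinite form on `𝓕_ℂ ⊗ 𝓕_ℂ`, in Mathlib's convention, in which `inner ℂ s t`
is linear in `t`: `inner ℂ s t = ⟨t, s⟩`. -/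
@[reducible]
def preCore (p : Fin 3 → Plane) : PreInnerProductSpace.Core ℂ (PreForm p) where
  inner s t := preInner p t s
  conj_inner_symm s t := by
    refine tendsto_nhds_unique
      ((Complex.continuous_conj.tendsto _).comp (tendsto_preInner s t)) ?_
    refine (tendsto_preInner t s).congr fun n => ?_
    simp only [Function.comp_apply, conj_edgeSum]
    refine congrArg (edgeSum p n) (funext fun x => funext fun y => ?_)
    simp only [map_div₀, map_add, map_mul, Complex.conj_conj, Complex.conj_ofNat]
    ring
  re_inner_nonneg s := ge_of_tendsto' (tendsto_preInner_self s) fun n =>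
    edgeSum_nonneg p n fun x y => by positivity
  add_left s₁ s₂ t := map_add _ _ _
  smul_left s t r := (preInner p t).map_smulₛₗ r s

instance (p : Fin 3 → Plane) : SeminormedAddCommGroup (PreForm p) :=
  @InnerProductSpace.Core.toSeminormedAddCommGroup ℂ (PreForm p) _ _ _ (preCore p)

instance (p : Fin 3 → Plane) : InnerProductSpace ℂ (PreForm p) :=
  InnerProductSpace.ofCore (preCore p)

theorem inner_preForm {p : Fin 3 → Plane} (s t : PreForm p) :
    inner ℂ s t = preInner p t s := rfl

/-- The space `𝓗_ℂ` of `1`-forms: the Hilbert space obtained from `𝓕_ℂ ⊗ 𝓕_ℂ` by factoring out the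
elements of norm zero and completing. -/
abbrev OneForm (p : Fin 3 → Plane) : Type := UniformSpace.Completion (PreForm p)

/-- The inner product `⟨v, w⟩_𝓗`, linear in `v` and conjugate linear in `w`. -/
def formInner {p : Fin 3 → Plane} (v w : OneForm p) : ℂ := inner ℂ w v

/-- The class of `a ⊗ b` in `𝓗_ℂ`. -/
def tensor {p : Fin 3 → Plane} (a b : FC p) : OneForm p := (PreForm.mk a b : PreForm p)

theorem formInner_tensor {p : Fin 3 → Plane} (a b c d : FC p) :
    formInner (tensor a b) (tensor c d) = mutualIntegral a c fun x => b.1 x * conj (d.1 x) := by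
  simp only [formInner, tensor, UniformSpace.Completion.inner_coe, inner_preForm, preInner_mk]

/-- The derivation `∂ : 𝓕_ℂ → 𝓗_ℂ`, `∂ f = f ⊗ 1`. -/
def derivation {p : Fin 3 → Plane} : FC p →ₗ[ℂ] OneForm p where
  toFun f := tensor f 1
  map_add' f g := by
    have h : PreForm.mk (f + g) 1 = PreForm.mk f 1 + PreForm.mk g 1 := TensorProduct.add_tmul _ _ _
    simp only [tensor, h, UniformSpace.Completion.coe_add]
  map_smul' c f := by
    have h : PreForm.mk (c • f) 1 = c • PreForm.mk f 1 := TensorProduct.smul_tmul' _ _ _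
    simp only [tensor, h, UniformSpace.Completion.coe_smul, RingHom.id_apply]

theorem formInner_derivation {p : Fin 3 → Plane} (f g : FC p) :
    formInner (derivation f) (derivation g) = energyForm f g := by
  have h : mutualIntegral f g (1 : C(Gasket p, ℂ)) = energyForm f g := by
    refine mutualIntegral_eq_lim ((tendsto_energyForm f g).congr fun n => ?_)
    simp
  rw [← h]
  refine (formInner_tensor f 1 g 1).trans (congrArg (mutualIntegral f g) (funext fun x => ?_))
  change (1 : ℂ) * conj (1 : ℂ) = 1
  simp

theorem norm_derivation {p : Fin 3 → Plane} (f : FC p) : ‖derivation f‖ = √(energy f) := by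
  rw [@norm_eq_sqrt_re_inner ℂ]
  have h : inner ℂ (derivation f) (derivation f) = (energy f : ℂ) :=
    (formInner_derivation f f).trans (energyForm_self f)
  rw [h]
  simp

/-- `(a ⊗ b) d = a ⊗ (b d)` on `𝓕_ℂ ⊗ 𝓕_ℂ`. -/
def preMul {p : Fin 3 → Plane} (d : FC p) : PreForm p →ₗ[ℂ] PreForm p :=
  TensorProduct.map LinearMap.id (LinearMap.mulRight ℂ d)

theorem edgeValue_preMul {p : Fin 3 → Plane} (d : FC p) (x y : Gasket p) (s : PreForm p) :
    edgeValue p x y (preMul d s) = d.1 x * edgeValue p x y s := by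
  induction s using PreForm.induction with
  | zero => simp
  | mk a b =>
    change b.1 x * d.1 x * (a.1 x - a.1 y) = d.1 x * (b.1 x * (a.1 x - a.1 y))
    ring
  | add s₁ s₂ h1 h2 => rw [map_add, map_add, map_add, h1, h2, mul_add]

theorem norm_sq_preForm {p : Fin 3 → Plane} (s : PreForm p) :
    ‖s‖ ^ 2 = (preInner p s s).re := norm_sq_eq_re_inner (𝕜 := ℂ) s

theorem norm_preMul_le {p : Fin 3 → Plane} (d : FC p) (s : PreForm p) :
    ‖preMul d s‖ ≤ ‖d.1‖ * ‖s‖ := by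
  refine le_of_sq_le_sq ?_ (by positivity)
  rw [mul_pow, norm_sq_preForm, norm_sq_preForm]
  refine le_of_tendsto_of_tendsto' (tendsto_preInner_self _)
    ((tendsto_preInner_self s).const_mul _) fun n => ?_
  refine le_of_le_of_eq (edgeSum_mono p n fun x y => ?_)
    (real_mul_edgeSum p n (‖d.1‖ ^ 2) _).symm
  simp only [edgeValue_preMul, norm_mul, mul_pow]
  have hx : ‖d.1 x‖ ^ 2 ≤ ‖d.1‖ ^ 2 := by gcongr; exact d.1.norm_coe_le_norm x
  have hy : ‖d.1 y‖ ^ 2 ≤ ‖d.1‖ ^ 2 := by gcongr; exact d.1.norm_coe_le_norm y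
  nlinarith [sq_nonneg ‖edgeValue p x y s‖, sq_nonneg ‖edgeValue p y x s‖]

/-- Multiplication `ω ↦ ω d` of `1`-forms by `d ∈ 𝓕_ℂ`: the continuous extension of
`(a ⊗ b) d = a ⊗ (b d)` to `𝓗_ℂ`. -/
def formMul {p : Fin 3 → Plane} (d : FC p) : OneForm p →L[ℂ] OneForm p :=
  ContinuousLinearMap.extend
    ((UniformSpace.Completion.toComplL (𝕜 := ℂ) (E := PreForm p)).comp
      ((preMul d).mkContinuous ‖d.1‖ (norm_preMul_le d)))
    (UniformSpace.Completion.toComplL (𝕜 := ℂ) (E := PreForm p))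

theorem formMul_coe {p : Fin 3 → Plane} (d : FC p) (s : PreForm p) :
    formMul d (s : OneForm p) = (preMul d s : PreForm p) :=
  ContinuousLinearMap.extend_eq _ UniformSpace.Completion.denseRange_coe
    (UniformSpace.Completion.isUniformInducing_coe _) s

theorem formMul_tensor {p : Fin 3 → Plane} (a b d : FC p) :
    formMul d (tensor a b) = tensor a (b * d) := formMul_coe d (.mk a b)

theorem norm_formMul_le {p : Fin 3 → Plane} (d : FC p) (v : OneForm p) :
    ‖formMul d v‖ ≤ ‖d.1‖ * ‖v‖ := by
  refine UniformSpace.Completion.induction_on v (isClosed_le (by fun_prop) (by fun_prop))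
    fun s => ?_
  rw [formMul_coe, UniformSpace.Completion.norm_coe, UniformSpace.Completion.norm_coe]
  exact norm_preMul_le d s

theorem formMul_add {p : Fin 3 → Plane} (d e : FC p) (v : OneForm p) :
    formMul (d + e) v = formMul d v + formMul e v := by
  refine UniformSpace.Completion.induction_on v (isClosed_eq (by fun_prop) (by fun_prop))
    fun s => ?_
  have h : preMul (d + e) s = preMul d s + preMul e s := by
    induction s using PreForm.induction with
    | zero => simp
    | mk a b =>
      change PreForm.mk a (b * (d + e)) = _
      rw [mul_add]
      exact TensorProduct.tmul_add _ _ _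
    | add s t hs ht => rw [map_add, map_add, map_add, hs, ht]; abel
  rw [formMul_coe, formMul_coe, formMul_coe, h, UniformSpace.Completion.coe_add]

theorem formMul_smul {p : Fin 3 → Plane} (c : ℂ) (d : FC p) (v : OneForm p) :
    formMul (c • d) v = c • formMul d v := by
  refine UniformSpace.Completion.induction_on v (isClosed_eq (formMul (c • d)).continuous
    (Continuous.const_smul (formMul d).continuous c)) fun s => ?_
  have h : preMul (c • d) s = c • preMul d s := by
    induction s using PreForm.induction with
    | zero => simp
    | mk a b =>
      change PreForm.mk a (b * (c • d)) = _
      rw [mul_smul_comm]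
      exact TensorProduct.tmul_smul _ _ _
    | add s t hs ht => rw [map_add, map_add, hs, ht, smul_add]
  rw [formMul_coe, formMul_coe, h, UniformSpace.Completion.coe_smul]

/-- The conjugation `a ⊗ b ↦ conj(a) ⊗ conj(b)` on `𝓕_ℂ ⊗ 𝓕_ℂ`. -/
def preConj (p : Fin 3 → Plane) : PreForm p →ₗ⋆[ℂ] PreForm p :=
  TensorProduct.map (starLinearEquiv ℂ (A := FC p)).toLinearMap
    (starLinearEquiv ℂ (A := FC p)).toLinearMap

theorem edgeValue_preConj {p : Fin 3 → Plane} (x y : Gasket p) (s : PreForm p) :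
    edgeValue p x y (preConj p s) = conj (edgeValue p x y s) := by
  induction s using PreForm.induction with
  | zero => simp
  | mk a b =>
    change conj (b.1 x) * (conj (a.1 x) - conj (a.1 y)) = conj (b.1 x * (a.1 x - a.1 y))
    simp
  | add s₁ s₂ h1 h2 => rw [map_add, map_add, map_add, h1, h2, map_add]

theorem norm_preConj {p : Fin 3 → Plane} (s : PreForm p) : ‖preConj p s‖ = ‖s‖ := by
  have h : ‖preConj p s‖ ^ 2 = ‖s‖ ^ 2 := by
    rw [norm_sq_preForm, norm_sq_preForm]
    refine tendsto_nhds_unique (tendsto_preInner_self _)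
      ((tendsto_preInner_self s).congr fun n => ?_)
    simp [edgeValue_preConj]
  exact (sq_eq_sq₀ (norm_nonneg _) (norm_nonneg _)).1 h

/-- Complex conjugation `v ↦ conj(v)` on `𝓗_ℂ`: the continuous extension of
`a ⊗ b ↦ conj(a) ⊗ conj(b)`. -/
def formConj (p : Fin 3 → Plane) : OneForm p →L⋆[ℂ] OneForm p :=
  ContinuousLinearMap.extend
    ((UniformSpace.Completion.toComplL (𝕜 := ℂ) (E := PreForm p)).comp
      ((preConj p).mkContinuous 1 fun s => by rw [norm_preConj, one_mul]))
    (UniformSpace.Completion.toComplL (𝕜 := ℂ) (E := PreForm p))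

theorem formConj_coe {p : Fin 3 → Plane} (s : PreForm p) :
    formConj p (s : OneForm p) = (preConj p s : PreForm p) :=
  ContinuousLinearMap.extend_eq _ UniformSpace.Completion.denseRange_coe
    (UniformSpace.Completion.isUniformInducing_coe _) s

theorem formConj_tensor {p : Fin 3 → Plane} (a b : FC p) :
    formConj p (tensor a b) = tensor (star a) (star b) := formConj_coe (.mk a b)

theorem norm_formConj {p : Fin 3 → Plane} (v : OneForm p) : ‖formConj p v‖ = ‖v‖ := by
  refine UniformSpace.Completion.induction_on v (isClosed_eq (by fun_prop) (by fun_prop))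
    fun s => ?_
  rw [formConj_coe, UniformSpace.Completion.norm_coe, UniformSpace.Completion.norm_coe,
    norm_preConj]

/-- `v` is a real vector field, `v ∈ 𝓗`. -/
def IsReal {p : Fin 3 → Plane} (v : OneForm p) : Prop := formConj p v = v

/-! ### The Kusuoka measure -/

/-- `h` is real valued. -/
def IsRealValued {p : Fin 3 → Plane} (h : FC p) : Prop := ∀ x, conj (h.1 x) = h.1 x

/-- `h ∈ 𝓕` is harmonic: it minimizes the energy among all functions in `𝓕` with the same values at
the three corners. -/
def IsHarmonic {p : Fin 3 → Plane} (h : FC p) : Prop :=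
  IsRealValued h ∧ ∀ u : FC p, IsRealValued u →
    (∀ i, u.1 (corner p i) = h.1 (corner p i)) → energy h ≤ energy u

/-- `h 0, h 1` is an energy orthonormal system of harmonic functions. As the harmonic functions
modulo constants form a two dimensional space, such a system is complete. -/
structure IsHarmonicSystem {p : Fin 3 → Plane} (h : Fin 2 → FC p) : Prop where
  harmonic : ∀ i, IsHarmonic (h i)
  orthonormal : ∀ i j, energyForm (h i) (h j) = if i = j then 1 else 0

/-- The Kusuoka measure `ν = ν_{h₁} + ν_{h₂}`. -/
def kusuokaMeasure {p : Fin 3 → Plane} (h : Fin 2 → FC p) : Measure (Gasket p) :=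
  energyMeasure (h 0) + energyMeasure (h 1)

instance {p : Fin 3 → Plane} (h : Fin 2 → FC p) : IsFiniteMeasure (kusuokaMeasure h) :=
  inferInstanceAs (IsFiniteMeasure (energyMeasure (h 0) + energyMeasure (h 1)))

/-! ### Distributions and the magnetic Schrödinger form -/

/-- The space `𝓕_ℂ^*` of distributions: the linear functionals on `𝓕_ℂ` that are bounded with
respect to the norm `‖φ‖_∞ + 𝓔(φ)^{1/2}`. -/
def Distribution (p : Fin 3 → Plane) : Submodule ℂ (FC p →ₗ[ℂ] ℂ) where
  carrier := {u | ∃ C, ∀ φ, ‖u φ‖ ≤ C * (‖φ.1‖ + √(energy φ))}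
  add_mem' := by
    rintro u v ⟨C, hC⟩ ⟨D, hD⟩
    refine ⟨C + D, fun φ => ?_⟩
    rw [add_mul]
    exact (norm_add_le _ _).trans (add_le_add (hC φ) (hD φ))
  zero_mem' := ⟨0, fun φ => by simp⟩
  smul_mem' := by
    rintro c u ⟨C, hC⟩
    refine ⟨‖c‖ * C, fun φ => ?_⟩
    rw [LinearMap.smul_apply, norm_smul, mul_assoc]
    exact mul_le_mul_of_nonneg_left (hC φ) (norm_nonneg c)

/-- The dual pairing `⟨u, g⟩ = u(conj g)`, linear in `u` and conjugate linear in `g`. For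
`u(φ) = ∫ φ w dν` it is the inner product of `w` and `g` in `L²(ν)`. -/
def pairing {p : Fin 3 → Plane} (u : Distribution p) (g : FC p) : ℂ := u.1 (star g)

theorem energy_star {p : Fin 3 → Plane} (f : FC p) : energy (star f) = energy f := by
  refine tendsto_nhds_unique (tendsto_energy _) ((tendsto_energy f).congr fun n => ?_)
  exact (discreteEnergy_star p n f.1).symm

/-- The divergence `∂^* v ∈ 𝓕_ℂ^*` of `v ∈ 𝓗_ℂ`, `(∂^* v)(φ) = -⟨v, ∂(conj φ)⟩_𝓗`. -/
def divergence {p : Fin 3 → Plane} (v : OneForm p) : Distribution p :=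
  ⟨{ toFun := fun φ => -formInner v (derivation (star φ))
     map_add' := fun φ ψ => by
      simp only [formInner, star_add, map_add, inner_add_left, neg_add]
     map_smul' := fun c φ => by
      simp only [formInner, star_smul, map_smul, inner_smul_left, RingHom.id_apply, smul_eq_mul,
        mul_neg, RCLike.star_def, Complex.conj_conj] },
    ⟨‖v‖, fun φ => by
      refine (norm_neg _).trans_le ((norm_inner_le_norm _ _).trans ?_)
      rw [norm_derivation, energy_star, mul_comm]
      gcongr
      exact le_add_of_nonneg_left (norm_nonneg _)⟩⟩

/-- The energy Laplacian `Δ_ν f ∈ 𝓕_ℂ^*` of `f ∈ 𝓕_ℂ`, given by `⟨Δ_ν f, g⟩ = -𝓔(f, g)`. -/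
def laplacian {p : Fin 3 → Plane} (f : FC p) : Distribution p :=
  ⟨{ toFun := fun φ => -energyForm f (star φ)
     map_add' := fun φ ψ => by
      simp only [← formInner_derivation, formInner, star_add, map_add, inner_add_left, neg_add]
     map_smul' := fun c φ => by
      simp only [← formInner_derivation, formInner, star_smul, map_smul, inner_smul_left,
        RingHom.id_apply, smul_eq_mul, mul_neg, RCLike.star_def, Complex.conj_conj] },
    ⟨√(energy f), fun φ => by
      refine (norm_neg _).trans_le ?_
      rw [← formInner_derivation]
      refine (norm_inner_le_norm _ _).trans ?_
      rw [norm_derivation, norm_derivation, energy_star, mul_comm]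
      gcongr
      exact le_add_of_nonneg_left (norm_nonneg _)⟩⟩

/-- The map `a^* : 𝓗_ℂ → 𝓕_ℂ^*`, `(a^* v)(φ) = ⟨a φ, conj v⟩_𝓗`, for a vector field `a`. -/
def adjointMul {p : Fin 3 → Plane} (a v : OneForm p) : Distribution p :=
  ⟨{ toFun := fun φ => formInner (formMul φ a) (formConj p v)
     map_add' := fun φ ψ => by
      simp only [formInner, formMul_add, inner_add_right]
     map_smul' := fun c φ => by
      simp only [formInner, formMul_smul, inner_smul_right, RingHom.id_apply, smul_eq_mul] },
    ⟨‖v‖ * ‖a‖, fun φ => by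
      refine (norm_inner_le_norm (𝕜 := ℂ) (formConj p v) (formMul φ a)).trans ?_
      rw [norm_formConj, mul_assoc]
      have h := norm_formMul_le φ a
      have h2 : ‖φ.1‖ * ‖a‖ ≤ ‖a‖ * (‖φ.1‖ + √(energy φ)) := by
        rw [mul_comm]
        gcongr
        exact le_add_of_nonneg_right (Real.sqrt_nonneg _)
      exact mul_le_mul_of_nonneg_left (h.trans h2) (norm_nonneg v)⟩⟩

theorem energy_mul_le {p : Fin 3 → Plane} (f g : FC p) :
    energy (f * g) ≤ 2 * ‖g.1‖ ^ 2 * energy f + 2 * ‖f.1‖ ^ 2 * energy g :=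
  le_of_tendsto_of_tendsto' (tendsto_energy (f * g))
    (((tendsto_energy f).const_mul _).add ((tendsto_energy g).const_mul _))
    fun n => discreteEnergy_mul_le p n f.1 g.1

theorem mul_norm_bound {A B s t e : ℝ} (hA : 0 ≤ A) (hB : 0 ≤ B) (hs : 0 ≤ s) (ht : 0 ≤ t)
    (he : e ≤ 2 * B ^ 2 * s + 2 * A ^ 2 * t) :
    A * B + √e ≤ (B + √(2 * B ^ 2 + 2 * t)) * (A + √s) := by
  have hr := Real.sqrt_nonneg s
  have h1 : √e ≤ √(2 * B ^ 2 + 2 * t) * (A + √s) := by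
    rw [← Real.sqrt_sq (add_nonneg hA hr), ← Real.sqrt_mul (by positivity)]
    refine Real.sqrt_le_sqrt (he.trans ?_)
    have h2 : s ≤ (A + √s) ^ 2 := by nlinarith [Real.sq_sqrt hs, mul_nonneg hA hr]
    have h3 : A ^ 2 ≤ (A + √s) ^ 2 := by nlinarith [Real.sq_sqrt hs, mul_nonneg hA hr]
    have h4 := mul_le_mul_of_nonneg_left h2 (sq_nonneg B)
    have h5 := mul_le_mul_of_nonneg_left h3 ht
    linarith
  have h6 : 0 ≤ B * √s := mul_nonneg hB hr
  linarith

/-- The product `f u ∈ 𝓕_ℂ^*` of `f ∈ 𝓕_ℂ` and `u ∈ 𝓕_ℂ^*`, `(f u)(φ) = u(φ f)`. -/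
def mulDistribution {p : Fin 3 → Plane} (f : FC p) (u : Distribution p) : Distribution p :=
  ⟨u.1.comp (LinearMap.mulRight ℂ f), by
    obtain ⟨C, hC⟩ := u.2
    refine ⟨|C| * (‖f.1‖ + √(2 * ‖f.1‖ ^ 2 + 2 * energy f)), fun φ => ?_⟩
    have h1 : ‖(φ * f).1‖ ≤ ‖φ.1‖ * ‖f.1‖ := norm_mul_le φ.1 f.1
    have h2 := mul_norm_bound (norm_nonneg φ.1) (norm_nonneg f.1) (energy_nonneg φ)
      (energy_nonneg f) (energy_mul_le φ f)
    have h3 : ‖(φ * f).1‖ + √(energy (φ * f)) ≤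
        (‖f.1‖ + √(2 * ‖f.1‖ ^ 2 + 2 * energy f)) * (‖φ.1‖ + √(energy φ)) :=
      (add_le_add_left h1 _).trans h2
    have h4 : 0 ≤ ‖(φ * f).1‖ + √(energy (φ * f)) :=
      add_nonneg (norm_nonneg _) (Real.sqrt_nonneg _)
    refine (hC (φ * f)).trans ?_
    rw [mul_assoc]
    exact (mul_le_mul_of_nonneg_right (le_abs_self C) h4).trans
      (mul_le_mul_of_nonneg_left h3 (abs_nonneg C))⟩

theorem integrable_potential {p : Fin 3 → Plane} {h : Fin 2 → FC p}
    (V : Lp ℝ ∞ (kusuokaMeasure h)) (f φ : FC p) :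
    Integrable (fun x => f.1 x * (V x : ℂ) * φ.1 x) (kusuokaMeasure h) := by
  have hV : MemLp (fun x => (V x : ℂ)) ∞ (kusuokaMeasure h) := (Lp.memLp V).ofReal
  have hb : ∀ g : FC p, ∀ x, ‖g.1 x‖ ≤ ‖g.1‖ := fun g x => g.1.norm_coe_le_norm x
  have h1 : Integrable (fun x => (V x : ℂ)) (kusuokaMeasure h) := hV.integrable le_top
  have h2 := h1.bdd_mul (c := ‖f.1‖) f.1.continuous.aestronglyMeasurable (ae_of_all _ (hb f))
  exact h2.mul_bdd (c := ‖φ.1‖) φ.1.continuous.aestronglyMeasurable (ae_of_all _ (hb φ))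

/-- The product `V f ∈ 𝓕_ℂ^*`, `(V f)(φ) = ∫ f V φ dν`, for real `V ∈ L^∞(ν)` and `f ∈ 𝓕_ℂ`. -/
def potentialMul {p : Fin 3 → Plane} {h : Fin 2 → FC p} (V : Lp ℝ ∞ (kusuokaMeasure h))
    (f : FC p) : Distribution p :=
  ⟨{ toFun := fun φ => ∫ x, f.1 x * (V x : ℂ) * φ.1 x ∂kusuokaMeasure h
     map_add' := fun φ ψ => by
      rw [← integral_add (integrable_potential V f φ) (integrable_potential V f ψ)]
      exact integral_congr_ae (ae_of_all _ fun x => mul_add _ _ _)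
     map_smul' := fun c φ => by
      rw [RingHom.id_apply, ← integral_smul]
      exact integral_congr_ae (ae_of_all _ fun x => mul_left_comm _ _ _) },
    ⟨∫ x, ‖f.1 x * (V x : ℂ)‖ ∂kusuokaMeasure h, fun φ => by
      have h1 : Integrable (fun x => f.1 x * (V x : ℂ)) (kusuokaMeasure h) := by
        simpa using integrable_potential V f 1
      refine (norm_integral_le_integral_norm _).trans ?_
      rw [← integral_mul_const]
      refine integral_mono (integrable_potential V f φ).norm (h1.norm.mul_const _) fun x => ?_
      change ‖f.1 x * (V x : ℂ) * φ.1 x‖ ≤ ‖f.1 x * (V x : ℂ)‖ * (‖φ.1‖ + √(energy φ))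
      rw [norm_mul]
      gcongr
      exact (φ.1.norm_coe_le_norm x).trans (le_add_of_nonneg_right (Real.sqrt_nonneg _))⟩⟩

/-- The form `𝓔^{a,V}(f, g) = ⟨(-Δ_ν + 2i a^* ∂ + a^* a + i (∂^* a) + V) f, g⟩` on `𝓕_ℂ`. -/
def magneticForm {p : Fin 3 → Plane} {h : Fin 2 → FC p} (a : OneForm p)
    (V : Lp ℝ ∞ (kusuokaMeasure h)) (f g : FC p) : ℂ :=
  pairing (-laplacian f + (2 * Complex.I) • adjointMul a (derivation f) +
    adjointMul a (formMul f a) + Complex.I • mulDistribution f (divergence a) +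
    potentialMul V f) g

/-- `(-i ∂ - a) f = -i ∂f - f a`. -/
def magneticDerivation {p : Fin 3 → Plane} (a : OneForm p) (f : FC p) : OneForm p :=
  (-Complex.I) • derivation f - formMul f a

/-- A quadratic form on `𝓕_ℂ`: linear in the first argument and conjugate symmetric (hence
conjugate linear in the second argument). -/
structure IsQuadraticForm {p : Fin 3 → Plane} (Q : FC p → FC p → ℂ) : Prop where
  add_left : ∀ f₁ f₂ g, Q (f₁ + f₂) g = Q f₁ g + Q f₂ g
  smul_left : ∀ (c : ℂ) (f g : FC p), Q (c • f) g = c * Q f g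
  conj_symm : ∀ f g, conj (Q f g) = Q g f

/-- `p 0, p 1, p 2` are the vertices of a (nondegenerate) equilateral triangle. -/
def IsEquilateral (p : Fin 3 → Plane) : Prop :=
  ∃ r : ℝ, 0 < r ∧ ∀ i j, i ≠ j → dist (p i) (p j) = r

end SierpinskiGasket

end

namespace SierpinskiGasket

variable {p : Fin 3 → Plane}

/-- Monotonicity of edge sums, where the summands are compared only on the edges of level `n`. -/
theorem edgeSum_mono_of_edges (n : ℕ) {F G : Gasket p → Gasket p → ℝ}
    (h : ∀ w : List (Fin 3), w.length = n → ∀ x y,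
      F (cellMap p w x) (cellMap p w y) ≤ G (cellMap p w x) (cellMap p w y)) :
    edgeSum p n F ≤ edgeSum p n G := by
  unfold edgeSum
  refine smul_le_smul_of_nonneg_left ?_ (by positivity)
  exact Finset.sum_le_sum fun w _ => Finset.sum_le_sum fun _ _ => Finset.sum_le_sum fun _ _ =>
    h (List.ofFn w) (List.length_ofFn) _ _

theorem exists_norm_osc_le (φ : C(Gasket p, ℂ)) {ε : ℝ} (hε : 0 < ε) :
    ∃ N : ℕ, ∀ w : List (Fin 3), N ≤ w.length → ∀ x y,
      ‖φ (cellMap p w x) - φ (cellMap p w y)‖ ≤ ε := by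
  obtain ⟨N₁, h₁⟩ := exists_osc_le p ⟨fun x => (φ x).re, by fun_prop⟩ (half_pos hε)
  obtain ⟨N₂, h₂⟩ := exists_osc_le p ⟨fun x => (φ x).im, by fun_prop⟩ (half_pos hε)
  refine ⟨max N₁ N₂, fun w hw x y => (Complex.norm_le_abs_re_add_abs_im _).trans ?_⟩
  have a := h₁ w ((le_max_left _ _).trans hw) x y
  have b := h₂ w ((le_max_right _ _).trans hw) x y
  simp only [ContinuousMap.coe_mk] at a b
  simp only [Complex.sub_re, Complex.sub_im]
  linarith

/-- The fourth order terms `(5/3)ⁿ ∑ |f(x) - f(y)|² |g(x) - g(y)|²` vanish in the limit. -/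
theorem tendsto_edgeSum_sq_mul_sq (f g : FC p) :
    Tendsto (fun n => edgeSum p n fun x y => ‖f.1 x - f.1 y‖ ^ 2 * ‖g.1 x - g.1 y‖ ^ 2)
      atTop (𝓝 0) := by
  rw [Metric.tendsto_atTop]
  intro ε hε
  have hE := energy_nonneg g
  obtain ⟨N, hN⟩ := exists_norm_osc_le f.1 (ε := √(ε / (energy g + 1)))
    (Real.sqrt_pos.2 (by positivity))
  refine ⟨N, fun n hn => ?_⟩
  rw [Real.dist_eq, sub_zero, abs_of_nonneg (edgeSum_nonneg p n fun x y => by positivity)]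
  have h : edgeSum p n (fun x y => ‖f.1 x - f.1 y‖ ^ 2 * ‖g.1 x - g.1 y‖ ^ 2) ≤
      ε / (energy g + 1) * discreteEnergy p n g.1 := by
    rw [discreteEnergy, real_mul_edgeSum]
    refine edgeSum_mono_of_edges n fun w hw x y => mul_le_mul_of_nonneg_right ?_ (sq_nonneg _)
    exact (Real.le_sqrt (norm_nonneg _) (by positivity)).1 (hN w (hw ▸ hn) x y)
  refine h.trans_lt ?_
  rw [div_mul_eq_mul_div, div_lt_iff₀ (by positivity)]
  exact mul_lt_mul_of_pos_left (by linarith [discreteEnergy_le_energy g n]) hε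

/-- The Leibniz rule `∂(fg) = (∂f) g + (∂g) f`. -/
theorem derivation_mul (f g : FC p) :
    derivation (f * g) = formMul g (derivation f) + formMul f (derivation g) := by
  set s : PreForm p := .mk (f * g) 1 - (preMul g (.mk f 1) + preMul f (.mk g 1)) with hs
  have hv : ∀ x y, ‖edgeValue p x y s‖ ^ 2 = ‖f.1 x - f.1 y‖ ^ 2 * ‖g.1 x - g.1 y‖ ^ 2 := by
    intro x y
    have hm : ∀ (u v : FC p) (z : Gasket p), (u * v).1 z = u.1 z * v.1 z := fun _ _ _ => rfl
    have h1 : ∀ z : Gasket p, (1 : FC p).1 z = 1 := fun _ => rfl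
    rw [← mul_pow, ← norm_mul, ← norm_neg (_ * _), hs, map_sub, map_add, edgeValue_preMul,
      edgeValue_preMul, edgeValue_mk, edgeValue_mk, edgeValue_mk, hm, hm, h1]
    congr 2
    ring
  have h0 : ‖s‖ = 0 := by
    rw [← sq_eq_zero_iff, norm_sq_preForm]
    refine tendsto_nhds_unique (tendsto_preInner_self s)
      ((tendsto_edgeSum_sq_mul_sq f g).congr fun n => ?_)
    refine congrArg (edgeSum p n) (funext fun x => funext fun y => ?_)
    rw [hv, hv, norm_sub_rev (f.1 y), norm_sub_rev (g.1 y)]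
    ring
  have h : (s : OneForm p) = derivation (f * g) -
      (formMul g (derivation f) + formMul f (derivation g)) := by
    change _ = (PreForm.mk (f * g) 1 : OneForm p) -
      (formMul g (PreForm.mk f 1 : PreForm p) + formMul f (PreForm.mk g 1 : PreForm p))
    rw [formMul_coe, formMul_coe, hs, UniformSpace.Completion.coe_sub,
      UniformSpace.Completion.coe_add]
  rw [← sub_eq_zero, ← h, ← norm_eq_zero, UniformSpace.Completion.norm_coe, h0]

/-- Multiplication by `conj f` is the adjoint of multiplication by `f`. -/
theorem formInner_formMul_left (f : FC p) (v w : OneForm p) :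
    formInner (formMul f v) w = formInner v (formMul (star f) w) := by
  unfold formInner
  refine UniformSpace.Completion.induction_on₂ v w
    (isClosed_eq (by fun_prop) (by fun_prop)) fun s t => ?_
  rw [formMul_coe, formMul_coe, UniformSpace.Completion.inner_coe,
    UniformSpace.Completion.inner_coe, inner_preForm, inner_preForm]
  refine tendsto_nhds_unique (tendsto_preInner _ _) ((tendsto_preInner _ _).congr fun n => ?_)
  refine congrArg (edgeSum p n) (funext fun x => funext fun y => ?_)
  have hstar : ∀ z : Gasket p, (star f).1 z = conj (f.1 z) := fun _ => rfl
  simp only [edgeValue_preMul, hstar, map_mul, Complex.conj_conj]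
  ring

theorem formInner_conj_symm (v w : OneForm p) : conj (formInner v w) = formInner w v :=
  inner_conj_symm v w

theorem formInner_formConj (v w : OneForm p) :
    formInner (formConj p v) (formConj p w) = formInner w v := by
  unfold formInner
  refine UniformSpace.Completion.induction_on₂ v w
    (isClosed_eq (by fun_prop) (by fun_prop)) fun s t => ?_
  rw [formConj_coe, formConj_coe, UniformSpace.Completion.inner_coe,
    UniformSpace.Completion.inner_coe, inner_preForm, inner_preForm]
  refine tendsto_nhds_unique (tendsto_preInner _ _) ((tendsto_preInner _ _).congr fun n => ?_)
  refine congrArg (edgeSum p n) (funext fun x => funext fun y => ?_)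
  simp only [edgeValue_preConj, Complex.conj_conj]
  ring

theorem formConj_formMul (f : FC p) (v : OneForm p) :
    formConj p (formMul f v) = formMul (star f) (formConj p v) := by
  refine UniformSpace.Completion.induction_on v (isClosed_eq (by fun_prop) (by fun_prop))
    fun s => ?_
  have h : preConj p (preMul f s) = preMul (star f) (preConj p s) := by
    induction s using PreForm.induction with
    | zero => simp
    | mk a b =>
      change PreForm.mk (star a) (star (b * f)) = PreForm.mk (star a) (star b * star f)
      rw [star_mul']
    | add s t hs ht => rw [map_add, map_add, hs, ht, map_add, map_add]
  rw [formMul_coe, formConj_coe, formConj_coe, formMul_coe, h]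

theorem formConj_derivation (f : FC p) : formConj p (derivation f) = derivation (star f) := by
  refine (formConj_tensor f 1).trans ?_
  rw [star_one]
  rfl

/-- For a real vector field `a`, `⟨a conj(g), conj(∂f)⟩ = ⟨∂f, g a⟩`. -/
theorem formInner_formMul_star_formConj {a : OneForm p} (ha : IsReal a) (g : FC p)
    (v : OneForm p) :
    formInner (formMul (star g) a) (formConj p v) = formInner v (formMul g a) := by
  rw [← formInner_formConj (formMul g a) v, formConj_formMul, ha]

theorem magneticForm_eq {h : Fin 2 → FC p} {a : OneForm p} (ha : IsReal a)
    (V : Lp ℝ ∞ (kusuokaMeasure h)) (f g : FC p) :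
    magneticForm a V f g =
      formInner (magneticDerivation a f) (magneticDerivation a g) +
        ∫ x, f.1 x * (V x : ℂ) * conj (g.1 x) ∂kusuokaMeasure h := by
  have e : magneticForm a V f g = - -energyForm f (star (star g)) +
      2 * Complex.I * formInner (formMul (star g) a) (formConj p (derivation f)) +
      formInner (formMul (star g) a) (formConj p (formMul f a)) +
      Complex.I * -formInner a (derivation (star (star g * f))) +
      ∫ x, f.1 x * (V x : ℂ) * conj (g.1 x) ∂kusuokaMeasure h := rfl
  have hL : formInner a (derivation (star (star g * f))) =
      formInner (formMul f a) (derivation g) + formInner (derivation f) (formMul g a) := by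
    rw [star_mul', star_star, derivation_mul, ← formInner_formMul_star_formConj ha,
      formConj_derivation, formInner_formMul_left, formInner_formMul_left, star_star]
    exact inner_add_left _ _ _
  rw [e, hL, formInner_formMul_star_formConj ha, formInner_formMul_star_formConj ha, star_star,
    ← formInner_derivation]
  simp only [magneticDerivation, formInner, inner_sub_left, inner_sub_right, inner_smul_left,
    inner_smul_right, map_neg, Complex.conj_I]
  linear_combination (inner ℂ (derivation g) (derivation f)) * Complex.I_mul_I

theorem magneticDerivation_add (a : OneForm p) (f g : FC p) :
    magneticDerivation a (f + g) = magneticDerivation a f + magneticDerivation a g := by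
  simp only [magneticDerivation, map_add, formMul_add, smul_add]
  abel

theorem magneticDerivation_smul (a : OneForm p) (c : ℂ) (f : FC p) :
    magneticDerivation a (c • f) = c • magneticDerivation a f := by
  simp only [magneticDerivation, map_smul, formMul_smul, smul_sub, smul_comm c]

theorem integral_potential_add_left {h : Fin 2 → FC p} (V : Lp ℝ ∞ (kusuokaMeasure h))
    (f₁ f₂ g : FC p) :
    ∫ x, (f₁ + f₂).1 x * (V x : ℂ) * conj (g.1 x) ∂kusuokaMeasure h =
      (∫ x, f₁.1 x * (V x : ℂ) * conj (g.1 x) ∂kusuokaMeasure h) +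
        ∫ x, f₂.1 x * (V x : ℂ) * conj (g.1 x) ∂kusuokaMeasure h := by
  refine Eq.trans (integral_congr_ae (ae_of_all _ fun x => ?_))
    (integral_add (integrable_potential V f₁ (star g)) (integrable_potential V f₂ (star g)))
  change (f₁.1 x + f₂.1 x) * (V x : ℂ) * conj (g.1 x) =
    f₁.1 x * (V x : ℂ) * conj (g.1 x) + f₂.1 x * (V x : ℂ) * conj (g.1 x)
  ring

theorem integral_potential_smul_left {h : Fin 2 → FC p} (V : Lp ℝ ∞ (kusuokaMeasure h))
    (c : ℂ) (f g : FC p) :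
    ∫ x, (c • f).1 x * (V x : ℂ) * conj (g.1 x) ∂kusuokaMeasure h =
      c * ∫ x, f.1 x * (V x : ℂ) * conj (g.1 x) ∂kusuokaMeasure h := by
  rw [← integral_const_mul]
  refine integral_congr_ae (ae_of_all _ fun x => ?_)
  change c * f.1 x * (V x : ℂ) * conj (g.1 x) = c * (f.1 x * (V x : ℂ) * conj (g.1 x))
  ring

theorem conj_integral_potential {h : Fin 2 → FC p} (V : Lp ℝ ∞ (kusuokaMeasure h)) (f g : FC p) :
    conj (∫ x, f.1 x * (V x : ℂ) * conj (g.1 x) ∂kusuokaMeasure h) =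
      ∫ x, g.1 x * (V x : ℂ) * conj (f.1 x) ∂kusuokaMeasure h := by
  rw [← integral_conj]
  refine integral_congr_ae (ae_of_all _ fun x => ?_)
  simp only [map_mul, Complex.conj_conj, Complex.conj_ofReal]
  ring

theorem isQuadraticForm_magneticForm {h : Fin 2 → FC p} {a : OneForm p} (ha : IsReal a)
    (V : Lp ℝ ∞ (kusuokaMeasure h)) : IsQuadraticForm (magneticForm a V) where
  add_left f₁ f₂ g := by
    simp only [magneticForm_eq ha, magneticDerivation_add, integral_potential_add_left, formInner,
      inner_add_right]
    ring
  smul_left c f g := by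
    simp only [magneticForm_eq ha, magneticDerivation_smul, integral_potential_smul_left,
      formInner, inner_smul_right]
    ring
  conj_symm f g := by
    rw [magneticForm_eq ha, magneticForm_eq ha, map_add, formInner_conj_symm,
      conj_integral_potential]

end SierpinskiGasket

theorem proposition4 (p : Fin 3 → SierpinskiGasket.Plane) (hp : SierpinskiGasket.IsEquilateral p)
    (h : Fin 2 → SierpinskiGasket.FC p) (hh : SierpinskiGasket.IsHarmonicSystem h)
    (a : SierpinskiGasket.OneForm p) (ha : SierpinskiGasket.IsReal a)
    (V : Lp ℝ ∞ (SierpinskiGasket.kusuokaMeasure h)) :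
    (∀ f g : SierpinskiGasket.FC p,
      SierpinskiGasket.magneticForm a V f g =
        SierpinskiGasket.formInner (SierpinskiGasket.magneticDerivation a f)
            (SierpinskiGasket.magneticDerivation a g) +
          ∫ x, f.1 x * (V x : ℂ) * conj (g.1 x) ∂SierpinskiGasket.kusuokaMeasure h) ∧
      SierpinskiGasket.IsQuadraticForm (SierpinskiGasket.magneticForm a V) ∧
      ∀ f : SierpinskiGasket.FC p, 0 ≤ (SierpinskiGasket.magneticForm a V f f -
        ∫ x, f.1 x * (V x : ℂ) * conj (f.1 x) ∂SierpinskiGasket.kusuokaMeasure h).re := by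
  refine ⟨SierpinskiGasket.magneticForm_eq ha V,
    SierpinskiGasket.isQuadraticForm_magneticForm ha V, fun f => ?_⟩
  rw [SierpinskiGasket.magneticForm_eq ha, add_sub_cancel_right]
  exact inner_self_nonneg (𝕜 := ℂ) (x := SierpinskiGasket.magneticDerivation a f)
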